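/- Let $n \ge 2$ and $d \ge 3$ be integers, and let $V$ be a smooth hypersurface of degree $d$ in $\mathbf{P}^n$ over $\mathbf{C}$; that is, $V$ is the zero locus of a nonzero homogeneous form $F \in \mathbf{C}[X_0,\dots,X_n]$ of degree $d$ whose partial derivatives $\partial F/\partial X_0, \dots, \partial F/\partial X_n$ do not all vanish at any point of $V$. Let $\Phi$ be the subgroup of $\mathrm{PGL}_{n+1}(\mathbf{C})$ which stabilises $V$, i.e. the group of all $g$ with $g(V) = V$. Then $\Phi$ is finite. -/

import Mathlib

open scoped Pointwise LinearAlgebra.Projectivization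

/-- The zero locus in the projective space `ℙⁿ(ℂ)` of a form `F` in the coordinates
`X₀, …, Xₙ`. For homogeneous `F` it does not depend on the chosen representatives, see
`mk_mem_projZeroLocus`. -/
def projZeroLocus {n : ℕ} (F : MvPolynomial (Fin (n + 1)) ℂ) :
    Set (ℙ ℂ (Fin (n + 1) → ℂ)) :=
  {P | MvPolynomial.eval P.rep F = 0}

theorem mk_mem_projZeroLocus {n d : ℕ} {F : MvPolynomial (Fin (n + 1)) ℂ}
    (hF : F.IsHomogeneous d) (v : Fin (n + 1) → ℂ) (hv : v ≠ 0) :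
    Projectivization.mk ℂ v hv ∈ projZeroLocus F ↔ MvPolynomial.eval v F = 0 := by
  obtain ⟨a, ha⟩ := Projectivization.exists_smul_eq_mk_rep ℂ v hv
  have key : MvPolynomial.eval ((a : ℂ) • v) F = (a : ℂ) ^ d * MvPolynomial.eval v F := by
    rw [MvPolynomial.eval_eq', MvPolynomial.eval_eq', Finset.mul_sum]
    refine Finset.sum_congr rfl fun m hm => ?_
    have hdeg : ∑ i, m i = d := by
      rw [hF.degree_eq_sum_deg_support hm]
      exact (Finset.sum_subset (Finset.subset_univ _) fun i _ hi => by simpa using hi).symm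
    simp only [Pi.smul_apply, smul_eq_mul, mul_pow, Finset.prod_mul_distrib,
      Finset.prod_pow_eq_pow_sum, hdeg]
    ring
  have ha' : (a : ℂ) • v = (Projectivization.mk ℂ v hv).rep := ha
  rw [projZeroLocus, Set.mem_ofPred_eq, ← ha', key]
  simp

/-- `V` is a smooth hypersurface of degree `d` in `ℙⁿ` over `ℂ`, given by its set of complex
points: the zero locus of a nonzero form `F` of degree `d` whose partial derivatives do not all
vanish at any point of the locus (the Jacobian criterion). For `n ≥ 1` the latter forces `F` to be
squarefree, so that `V` with its reduced structure is the scheme `F = 0`. -/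
def IsSmoothHypersurface (n d : ℕ) (V : Set (ℙ ℂ (Fin (n + 1) → ℂ))) : Prop :=
  ∃ F : MvPolynomial (Fin (n + 1)) ℂ, F ≠ 0 ∧ F.IsHomogeneous d ∧ V = projZeroLocus F ∧
    ∀ v : Fin (n + 1) → ℂ, v ≠ 0 → MvPolynomial.eval v F = 0 →
      ∃ i, MvPolynomial.eval v (MvPolynomial.pderiv i F) ≠ 0

/-! Any `g` stabilising `V` satisfies `F ∘ g = c F`: smoothness makes `F` squarefree, so the
Nullstellensatz gives `F ∣ F ∘ g`, and the degrees agree. Rescaling `g` by a `d`-th root of `c⁻¹`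
reduces the claim to finiteness of the linear group fixing `F`.

By Euler's identity and smoothness, `dF` vanishes only at `0`; it is homogeneous of degree `d - 1 ≥
2`. A growth estimate then bounds the group. Were it infinite, compactness would yield elements `≠
1` tending to `1`, hence a nonzero `A` with `dF_x(A x) = 0` for all `x`. Then `exp (t A)` fixes `F`,
so it is a bounded entire function of `t`; by Liouville it is constant and `A = 0`. -/

/-! ### Analysis: linear symmetries of a homogeneous function -/

open Filter Topology in
theorem exists_norm_pow_bounds_of_homogeneous {E G : Type*} [NormedAddCommGroup E]
    [NormedSpace ℂ E] [FiniteDimensional ℂ E] [NormedAddCommGroup G] [NormedSpace ℂ G]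
    {φ : E → G} {m : ℕ} (hm : m ≠ 0) (hcont : Continuous φ)
    (hhom : ∀ (a : ℂ) x, φ (a • x) = a ^ m • φ x) (hne : ∀ x, x ≠ 0 → φ x ≠ 0) :
    ∃ K : ℝ, 0 < K ∧ (∀ x, ‖φ x‖ ≤ K * ‖x‖ ^ m) ∧ ∀ x, ‖x‖ ^ m ≤ K * ‖φ x‖ := by
  have : ProperSpace E := FiniteDimensional.proper ℂ E
  have hs : ∀ x ∈ Metric.sphere (0 : E) 1, φ x ≠ 0 := fun x hx =>
    hne x (by rintro rfl; simp at hx)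
  obtain ⟨C₁, h₁⟩ := (isCompact_sphere (0 : E) 1).exists_bound_of_continuousOn hcont.continuousOn
  obtain ⟨C₂, h₂⟩ := (isCompact_sphere (0 : E) 1).exists_bound_of_continuousOn
    (f := fun x => ‖φ x‖⁻¹)
    (hcont.norm.continuousOn.inv₀ fun x hx => norm_ne_zero_iff.2 (hs x hx))
  have h0 : φ 0 = 0 := by simpa [hm] using hhom 0 0
  set K := max (max C₁ C₂) 1
  have key : ∀ x : E, x ≠ 0 → ∃ u ∈ Metric.sphere (0 : E) 1, ‖φ x‖ = ‖x‖ ^ m * ‖φ u‖ := by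
    intro x hx
    have hx' : ‖x‖ ≠ 0 := norm_ne_zero_iff.2 hx
    refine ⟨(‖x‖⁻¹ : ℂ) • x, by simp [norm_smul, hx'], ?_⟩
    rw [hhom, norm_smul]
    simp only [norm_pow, norm_inv, Complex.norm_real, norm_norm, inv_pow]
    field_simp
  refine ⟨K, lt_max_of_lt_right one_pos, fun x => ?_, fun x => ?_⟩ <;>
    rcases eq_or_ne x 0 with rfl | hx
  · simp [h0, hm]
  · obtain ⟨u, hu, h⟩ := key x hx
    rw [h, mul_comm]
    gcongr
    exact (h₁ u hu).trans ((le_max_left _ _).trans (le_max_left _ _))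
  · simp [h0, hm]
  · obtain ⟨u, hu, h⟩ := key x hx
    have hpos : 0 < ‖φ u‖ := norm_pos_iff.2 (hs u hu)
    have h3 : ‖φ u‖⁻¹ ≤ K := by
      have := h₂ u hu
      rw [norm_inv, norm_norm] at this
      exact this.trans ((le_max_right _ _).trans (le_max_left _ _))
    have h4 : 1 ≤ K * ‖φ u‖ := by
      rwa [inv_le_iff_one_le_mul₀ hpos] at h3
    rw [h]
    calc ‖x‖ ^ m = ‖x‖ ^ m * 1 := (mul_one _).symm
      _ ≤ ‖x‖ ^ m * (K * ‖φ u‖) := by gcongr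
      _ = _ := by ring

/-- The larger of `a` and `b`, say `t`, satisfies `t ^ m ≤ K * t`; for `t > 1` and `m ≥ 2` this
forces `t ≤ K`. -/
theorem le_max_one_of_pow_le_mul {a b K : ℝ} {m : ℕ} (hm : 2 ≤ m) (ha : 0 ≤ a) (hb : 0 ≤ b)
    (hK : 0 ≤ K) (hab : a ^ m ≤ K * b) (hba : b ^ m ≤ K * a) : a ≤ max 1 K := by
  have key : ∀ {t : ℝ}, 0 ≤ t → t ^ m ≤ K * t → t ≤ max 1 K := by
    intro t ht h
    rcases le_or_gt t 1 with h1 | h1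
    · exact h1.trans (le_max_left _ _)
    · refine le_trans ?_ (le_max_right _ _)
      have h2 : t ^ 2 ≤ t ^ m := pow_le_pow_right₀ h1.le hm
      nlinarith
  rcases le_total b a with h | h
  · exact key ha (hab.trans (by gcongr))
  · exact h.trans (key hb (hba.trans (by gcongr)))

theorem norm_pow_le_of_forall_apply {E : Type*} [NormedAddCommGroup E] [NormedSpace ℂ E]
    {T : E →L[ℂ] E} {m : ℕ} (hm : m ≠ 0) {M : ℝ} (hM : 0 ≤ M)
    (h : ∀ x, ‖T x‖ ^ m ≤ M * ‖x‖ ^ m) : ‖T‖ ^ m ≤ M := by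
  have hr : (M ^ ((m : ℝ)⁻¹)) ^ m = M := Real.rpow_inv_natCast_pow hM hm
  have hr0 : 0 ≤ M ^ ((m : ℝ)⁻¹) := Real.rpow_nonneg hM _
  rw [← hr]
  gcongr
  refine T.opNorm_le_bound hr0 fun x => ?_
  refine le_of_pow_le_pow_left₀ hm (by positivity) ?_
  rw [mul_pow, hr]
  exact h x

/-- The chain rule gives `φ (g x) = φ x ∘ g⁻¹`. Since `‖φ x‖` is comparable to `‖x‖ ^ m`, this
bounds `‖g‖ ^ m` by a multiple of `‖g⁻¹‖`, and symmetrically for `g⁻¹`. -/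
theorem exists_norm_le_of_comp_eq {E : Type*} [NormedAddCommGroup E] [NormedSpace ℂ E]
    [FiniteDimensional ℂ E] {f : E → ℂ} {φ : E → E →L[ℂ] ℂ} {m : ℕ} (hm : 2 ≤ m)
    (hf : ∀ x, HasFDerivAt f (φ x) x) (hcont : Continuous φ)
    (hhom : ∀ (a : ℂ) x, φ (a • x) = a ^ m • φ x) (hne : ∀ x, x ≠ 0 → φ x ≠ 0) :
    ∃ R : ℝ, ∀ g : (E →L[ℂ] E)ˣ, (∀ x, f ((g : E →L[ℂ] E) x) = f x) →
      ‖(g : E →L[ℂ] E)‖ ≤ R := by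
  obtain ⟨K, hK, h₁, h₂⟩ := exists_norm_pow_bounds_of_homogeneous (by omega) hcont hhom hne
  have key : ∀ g : (E →L[ℂ] E)ˣ, (∀ x, f ((g : E →L[ℂ] E) x) = f x) →
      ‖(g : E →L[ℂ] E)‖ ^ m ≤ (K * K) * ‖((g⁻¹ : (E →L[ℂ] E)ˣ) : E →L[ℂ] E)‖ := by
    intro g hg
    refine norm_pow_le_of_forall_apply (by omega) (by positivity) fun x => ?_
    have hd : (φ ((g : E →L[ℂ] E) x)).comp (g : E →L[ℂ] E) = φ x := by
      have h3 := (hf ((g : E →L[ℂ] E) x)).comp x (g : E →L[ℂ] E).hasFDerivAt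
      have h4 : f ∘ (g : E →L[ℂ] E) = f := funext hg
      rw [h4] at h3
      exact h3.unique (hf x)
    have hd' : φ ((g : E →L[ℂ] E) x) =
        (φ x).comp ((g⁻¹ : (E →L[ℂ] E)ˣ) : E →L[ℂ] E) := by
      rw [← hd, ContinuousLinearMap.comp_assoc]
      have : (g : E →L[ℂ] E).comp ((g⁻¹ : (E →L[ℂ] E)ˣ) : E →L[ℂ] E) = 1 := g.mul_inv
      rw [this]; rfl
    calc ‖(g : E →L[ℂ] E) x‖ ^ m ≤ K * ‖φ ((g : E →L[ℂ] E) x)‖ := h₂ _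
      _ ≤ K * (‖φ x‖ * ‖((g⁻¹ : (E →L[ℂ] E)ˣ) : E →L[ℂ] E)‖) := by
        rw [hd']; gcongr; exact ContinuousLinearMap.opNorm_comp_le _ _
      _ ≤ K * ((K * ‖x‖ ^ m) * ‖((g⁻¹ : (E →L[ℂ] E)ˣ) : E →L[ℂ] E)‖) := by
        gcongr; exact h₁ x
      _ = _ := by ring
  refine ⟨max 1 (K * K), fun g hg => ?_⟩
  refine le_max_one_of_pow_le_mul hm (norm_nonneg _) (norm_nonneg _) (by positivity)
    (key g hg) ?_
  have hg' : ∀ x, f (((g⁻¹ : (E →L[ℂ] E)ˣ) : E →L[ℂ] E) x) = f x := fun x => by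
    rw [← hg]
    congr 1
    exact congrArg (fun T : E →L[ℂ] E => T x) g.mul_inv
  simpa using key g⁻¹ hg'

/-- The flow `exp (t A)` preserves `f`, so it is bounded by `R` for every complex `t`, and
Liouville's theorem applies. -/
theorem eq_zero_of_forall_fderiv_apply_eq_zero {E : Type*} [NormedAddCommGroup E]
    [NormedSpace ℂ E] [CompleteSpace E] {f : E → ℂ} {φ : E → E →L[ℂ] ℂ}
    (hf : ∀ x, HasFDerivAt f (φ x) x) {R : ℝ}
    (hR : ∀ g : (E →L[ℂ] E)ˣ, (∀ x, f ((g : E →L[ℂ] E) x) = f x) → ‖(g : E →L[ℂ] E)‖ ≤ R)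
    {A : E →L[ℂ] E} (hA : ∀ x, φ x (A x) = 0) : A = 0 := by
  let e : ℂ → E →L[ℂ] E := fun t => NormedSpace.exp (t • A)
  have he : ∀ t, HasDerivAt e (A * e t) t := fun t => hasDerivAt_exp_smul_const' A t
  have he0 : e 0 = 1 := by simp [e]
  have hinv : ∀ t x, f (e t x) = f x := by
    intro t x
    have hd : ∀ s, HasDerivAt (fun s => f (e s x)) 0 s := by
      intro s
      have h1 : HasDerivAt (fun s => e s x) ((A * e s) x) s := by
        simpa using (he s).clm_apply (hasDerivAt_const s x)
      have h2 := (hf (e s x)).comp_hasDerivAt s h1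
      have h3 : φ (e s x) ((A * e s) x) = 0 := hA (e s x)
      rwa [h3] at h2
    have := is_const_of_deriv_eq_zero (fun s => (hd s).differentiableAt)
      (fun s => (hd s).deriv) t 0
    simpa [he0] using this
  have hb : ∀ t, ‖e t‖ ≤ R := by
    intro t
    let : NormedAlgebra ℚ (E →L[ℂ] E) := NormedAlgebra.restrictScalars ℚ ℂ _
    have hu : IsUnit (e t) := NormedSpace.isUnit_exp (t • A)
    have := hR hu.unit
    rw [hu.unit_spec] at this
    exact this (hinv t)
  have hconst : ∀ t, e t = 1 := fun t => by
    have hdiff : Differentiable ℂ e := fun t => (he t).differentiableAt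
    rw [← he0]
    exact hdiff.apply_eq_apply_of_bounded
      (isBounded_iff_forall_norm_le.2 ⟨R, by rintro _ ⟨t, rfl⟩; exact hb t⟩) t 0
  have h1 := he 0
  rw [he0, mul_one, funext hconst] at h1
  exact h1.unique (hasDerivAt_const 0 1)

-- `A` is a limit of the normalised differences `(h k - 1) / ‖h k - 1‖`, which lie on the compact
-- unit sphere.
open Filter Topology in
theorem exists_forall_fderiv_apply_eq_zero {E : Type*} [NormedAddCommGroup E] [NormedSpace ℂ E]
    [FiniteDimensional ℂ E] {f : E → ℂ} {φ : E → E →L[ℂ] ℂ}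
    (hf : ∀ x, HasFDerivAt f (φ x) x) {h : ℕ → E →L[ℂ] E} (hlim : Tendsto h atTop (𝓝 1))
    (hne : ∀ k, h k ≠ 1) (hinv : ∀ k x, f (h k x) = f x) :
    ∃ A : E →L[ℂ] E, A ≠ 0 ∧ ∀ x, φ x (A x) = 0 := by
  have : ProperSpace (E →L[ℂ] E) := FiniteDimensional.proper ℂ _
  have hpos : ∀ k, ‖h k - 1‖ ≠ 0 := fun k => norm_ne_zero_iff.2 (sub_ne_zero.2 (hne k))
  have hlim0 : Tendsto (fun k => h k - 1) atTop (𝓝 0) := by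
    simpa using hlim.sub_const 1
  let c : ℕ → ℂ := fun k => ((‖h k - 1‖⁻¹ : ℝ) : ℂ)
  obtain ⟨A, hA, s, hs, hsA⟩ := (isCompact_sphere (0 : E →L[ℂ] E) 1).tendsto_subseq
    (x := fun k => c k • (h k - 1)) (fun k => by simp [c, norm_smul, hpos k])
  refine ⟨A, by rintro rfl; simp at hA, fun x => ?_⟩
  have hd : Tendsto (fun k => (h (s k) - 1) x) atTop (𝓝 0) := by
    have := ((ContinuousLinearMap.apply ℂ E x).continuous.tendsto 0).comp
      (hlim0.comp hs.tendsto_atTop)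
    rwa [map_zero] at this
  have hcd : Tendsto (fun k => c (s k) • (h (s k) - 1) x) atTop (𝓝 (A x)) :=
    ((ContinuousLinearMap.apply ℂ E x).continuous.tendsto A).comp hsA
  have hF : HasFDerivWithinAt f (φ x) Set.univ x := (hf x).hasFDerivWithinAt
  have hl := hF.lim hd (Eventually.of_forall fun _ => Set.mem_univ _) hcd
  refine tendsto_nhds_unique hl ?_
  have : ∀ k, c (s k) • (f (x + (h (s k) - 1) x) - f x) = 0 := fun k => by
    have : x + (h (s k) - 1) x = h (s k) x := by simp
    rw [this, hinv, sub_self, smul_zero]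
  simp only [this]
  exact tendsto_const_nhds

open Filter Topology in
/-- The linear symmetry group of a function with nonvanishing derivative that is homogeneous of
degree at least two is finite. -/
theorem finite_setOf_units_comp_eq {E : Type*} [NormedAddCommGroup E] [NormedSpace ℂ E]
    [FiniteDimensional ℂ E] {f : E → ℂ} {φ : E → E →L[ℂ] ℂ} {m : ℕ} (hm : 2 ≤ m)
    (hf : ∀ x, HasFDerivAt f (φ x) x) (hcont : Continuous φ)
    (hhom : ∀ (a : ℂ) x, φ (a • x) = a ^ m • φ x) (hne : ∀ x, x ≠ 0 → φ x ≠ 0) :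
    {g : (E →L[ℂ] E)ˣ | ∀ x, f ((g : E →L[ℂ] E) x) = f x}.Finite := by
  have : CompleteSpace E := FiniteDimensional.complete ℂ E
  have : ProperSpace (E →L[ℂ] E) := FiniteDimensional.proper ℂ _
  obtain ⟨R, hR⟩ := exists_norm_le_of_comp_eq hm hf hcont hhom hne
  by_contra hinf
  let g := Set.Infinite.natEmbedding _ hinf
  have hg : ∀ k x, f (((g k : (E →L[ℂ] E)ˣ) : E →L[ℂ] E) x) = f x := fun k => (g k).2
  have hg' : ∀ k x, f ((((g k : (E →L[ℂ] E)ˣ)⁻¹ : (E →L[ℂ] E)ˣ) : E →L[ℂ] E) x) = f x := by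
    intro k x
    rw [← hg k]
    congr 1
    exact congrArg (fun T : E →L[ℂ] E => T x) (Units.mul_inv (g k : (E →L[ℂ] E)ˣ))
  obtain ⟨B, -, s, hs, hsB⟩ := (isCompact_closedBall (0 : E →L[ℂ] E) R).tendsto_subseq
    (x := fun k => ((g k : (E →L[ℂ] E)ˣ) : E →L[ℂ] E))
    (fun k => by simpa using hR _ (hg k))
  -- Quotients of consecutive terms tend to `1` because the inverses are bounded by `R` too, and
  -- differ from `1` because the terms are distinct.
  let u : ℕ → (E →L[ℂ] E)ˣ := fun k => (g (s k) : (E →L[ℂ] E)ˣ)⁻¹ * (g (s (k + 1)))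
  have hdiff : Tendsto (fun k => ((g (s (k + 1)) : (E →L[ℂ] E)ˣ) : E →L[ℂ] E) -
      ((g (s k) : (E →L[ℂ] E)ˣ) : E →L[ℂ] E)) atTop (𝓝 0) := by
    simpa using ((tendsto_add_atTop_iff_nat 1).2 hsB).sub hsB
  have hu : Tendsto (fun k => (u k : E →L[ℂ] E)) atTop (𝓝 1) := by
    rw [tendsto_iff_norm_sub_tendsto_zero]
    refine squeeze_zero (fun _ => norm_nonneg _) (fun k => ?_)
      (by simpa using hdiff.norm.const_mul R)
    have : (u k : E →L[ℂ] E) - 1 = (((g (s k) : (E →L[ℂ] E)ˣ)⁻¹ : (E →L[ℂ] E)ˣ) : E →L[ℂ] E) *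
        (((g (s (k + 1)) : (E →L[ℂ] E)ˣ) : E →L[ℂ] E) -
          ((g (s k) : (E →L[ℂ] E)ˣ) : E →L[ℂ] E)) := by
      rw [mul_sub, Units.inv_mul, Units.val_mul]
    rw [this]
    exact (norm_mul_le _ _).trans (by gcongr; exact hR _ (hg' _))
  obtain ⟨A, hA, h0⟩ := exists_forall_fderiv_apply_eq_zero hf hu
    (fun k h => by
      have h1 : u k = 1 := Units.ext h
      have h2 : g (s k) = g (s (k + 1)) := Subtype.ext (inv_mul_eq_one.1 h1)
      exact (hs (Nat.lt_succ_self k)).ne (g.injective h2))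
    (fun k x => by
      rw [Units.val_mul, mul_apply_eq_comp, hg', hg])
  exact hA (eq_zero_of_forall_fderiv_apply_eq_zero hf hR h0)

/-! ### Algebra: smooth forms and linear substitutions -/

namespace MvPolynomial

theorem hasFDerivAt_eval {σ : Type*} [Fintype σ] (F : MvPolynomial σ ℂ) (x : σ → ℂ) :
    HasFDerivAt (fun y => eval y F)
      (∑ i, eval x (pderiv i F) • ContinuousLinearMap.proj (R := ℂ) (φ := fun _ : σ => ℂ) i) x := by
  classical
  induction F using MvPolynomial.induction_on with
  | C a =>
    refine ((hasFDerivAt_const (𝕜 := ℂ) a x).congr_fderiv ?_).congr_of_eventuallyEq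
      (.of_forall fun y => by simp)
    ext v
    simp
  | add p q hp hq =>
    have h := hp.add hq
    refine (h.congr_fderiv ?_).congr_of_eventuallyEq (.of_forall fun y => by simp)
    ext v
    simp [add_mul, Finset.sum_add_distrib]
  | mul_X p i hp =>
    have h := hp.mul (ContinuousLinearMap.proj (R := ℂ) (φ := fun _ : σ => ℂ) i).hasFDerivAt
    refine (h.congr_fderiv ?_).congr_of_eventuallyEq (.of_forall fun y => by simp)
    ext v
    simp [pderiv_X, Pi.single_apply, apply_ite, add_mul, ite_mul, Finset.sum_add_distrib,
      Finset.mul_sum, mul_assoc]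

theorem IsHomogeneous.eval_smul {σ : Type*} {F : MvPolynomial σ ℂ} {d : ℕ}
    (hF : F.IsHomogeneous d) (a : ℂ) (v : σ → ℂ) : eval (a • v) F = a ^ d * eval v F := by
  rw [eval_eq, eval_eq, Finset.mul_sum]
  refine Finset.sum_congr rfl fun m hm => ?_
  simp only [Pi.smul_apply, smul_eq_mul, mul_pow, Finset.prod_mul_distrib,
    Finset.prod_pow_eq_pow_sum, hF.degree_eq_sum_deg_support hm]
  ring

/-- By the Nullstellensatz `P` divides a power of each variable, and powers of two distinct
variables are coprime. -/
theorem isUnit_of_forall_eval_ne_zero {σ : Type*} [Finite σ] [Nontrivial σ]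
    {P : MvPolynomial σ ℂ} (h : ∀ v, v ≠ 0 → eval v P ≠ 0) : IsUnit P := by
  have key : ∀ i, ∃ k, P ∣ X i ^ k := by
    intro i
    have hmem : (X i : MvPolynomial σ ℂ) ∈ (Ideal.span {P}).radical := by
      rw [← vanishingIdeal_zeroLocus_eq_radical (K := ℂ), mem_vanishingIdeal_iff]
      intro v hv
      have hv' : eval v P = 0 := by
        simpa [zeroLocus_span, aeval_eq_eval] using hv
      have : v = 0 := by
        by_contra hne
        exact h v hne hv'
      simp [this]
    obtain ⟨k, hk⟩ := hmem
    exact ⟨k, Ideal.mem_span_singleton.1 hk⟩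
  obtain ⟨i, j, hij⟩ := exists_pair_ne σ
  obtain ⟨k, hk⟩ := key i
  obtain ⟨l, hl⟩ := key j
  have hrel : IsRelPrime (X i : MvPolynomial σ ℂ) (X j) := by
    refine ((X_prime (R := ℂ) (i := i)).irreducible.isRelPrime_iff_not_dvd).2 fun hd => ?_
    exact hij ((X_dvd_X (R := ℂ)).1 hd)
  exact (hrel.pow_left.pow_right : IsRelPrime (X i ^ k : MvPolynomial σ ℂ) (X j ^ l)) hk hl

/-- At a zero of a repeated factor, `F` and all its partial derivatives vanish. -/
theorem squarefree_of_forall_exists_pderiv_ne_zero {σ : Type*} [Finite σ] [Nontrivial σ]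
    {F : MvPolynomial σ ℂ}
    (hF : ∀ v, v ≠ 0 → eval v F = 0 → ∃ i, eval v (pderiv i F) ≠ 0) : Squarefree F := by
  rintro P ⟨Q, rfl⟩
  refine isUnit_of_forall_eval_ne_zero fun v hv h0 => ?_
  obtain ⟨i, hi⟩ := hF v hv (by simp [h0])
  exact hi (by simp [h0])

theorem dvd_of_forall_eval_eq_zero {σ : Type*} [Finite σ] {F G : MvPolynomial σ ℂ}
    (hF : Squarefree F) (h : ∀ v, eval v F = 0 → eval v G = 0) : F ∣ G := by
  have hmem : G ∈ (Ideal.span {F}).radical := by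
    rw [← vanishingIdeal_zeroLocus_eq_radical (K := ℂ), mem_vanishingIdeal_iff]
    intro v hv
    rw [aeval_eq_eval]
    exact h v (by simpa [zeroLocus_span, aeval_eq_eval] using hv)
  obtain ⟨k, hk⟩ := hmem
  exact hF.isRadical k G (Ideal.mem_span_singleton.1 hk)

theorem IsHomogeneous.exists_eq_C_mul_of_dvd {σ : Type*} {F G : MvPolynomial σ ℂ} {d : ℕ}
    (hF : F.IsHomogeneous d) (hG : G.IsHomogeneous d) (hG0 : G ≠ 0) (h : F ∣ G) :
    ∃ c : ℂ, c ≠ 0 ∧ G = C c * F := by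
  obtain ⟨H, rfl⟩ := h
  have hF0 := left_ne_zero_of_mul hG0
  have hH0 := right_ne_zero_of_mul hG0
  have hdeg := totalDegree_mul_of_isDomain hF0 hH0
  rw [hG.totalDegree hG0, hF.totalDegree hF0] at hdeg
  have hH := totalDegree_eq_zero_iff_eq_C.1 (show H.totalDegree = 0 by omega)
  refine ⟨H.coeff 0, fun h0 => hH0 (by rw [hH, h0, C_0]), ?_⟩
  rw [← hH, mul_comm]

theorem exists_isHomogeneous_forall_eval_eq_eval_mulVec {σ : Type*} [Fintype σ]
    {F : MvPolynomial σ ℂ} {d : ℕ} (hF : F.IsHomogeneous d) (g : Matrix σ σ ℂ) :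
    ∃ G : MvPolynomial σ ℂ, G.IsHomogeneous d ∧ ∀ v, eval v G = eval (g.mulVec v) F := by
  refine ⟨aeval (fun i => ∑ j, C (g i j) * X j) F, ?_, fun v => ?_⟩
  · simpa using hF.aeval (n := 1) (fun i => ∑ j, C (g i j) * X j) fun i =>
      IsHomogeneous.sum _ _ _ fun j _ => isHomogeneous_C_mul_X _ _
  · rw [← aeval_eq_eval, ← AlgHom.comp_apply, comp_aeval, aeval_eq_eval]
    congr 2
    ext i
    simp [Matrix.mulVec, dotProduct, aeval_eq_eval]

/-- A linear substitution preserving the zero locus of a smooth form rescales the form. -/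
theorem exists_eval_mulVec_eq_mul {σ : Type*} [Fintype σ] [DecidableEq σ] [Nontrivial σ]
    {F : MvPolynomial σ ℂ} {d : ℕ} (hF0 : F ≠ 0) (hF : F.IsHomogeneous d)
    (hsm : ∀ v, v ≠ 0 → eval v F = 0 → ∃ i, eval v (pderiv i F) ≠ 0) (g : GL σ ℂ)
    (hg : ∀ v, eval v F = 0 → eval ((g : Matrix σ σ ℂ).mulVec v) F = 0) :
    ∃ c : ℂ, c ≠ 0 ∧ ∀ v, eval ((g : Matrix σ σ ℂ).mulVec v) F = c * eval v F := by
  obtain ⟨G, hG, hGe⟩ := exists_isHomogeneous_forall_eval_eq_eval_mulVec hF (g : Matrix σ σ ℂ)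
  have hG0 : G ≠ 0 := by
    rintro rfl
    refine hF0 (MvPolynomial.funext fun v => ?_)
    have := hGe ((g⁻¹ : GL σ ℂ).1.mulVec v)
    rw [Matrix.mulVec_mulVec, ← Units.val_mul, mul_inv_cancel] at this
    simpa using this.symm
  have hdvd := dvd_of_forall_eval_eq_zero (squarefree_of_forall_exists_pderiv_ne_zero hsm)
    (G := G) fun v hv => by rw [hGe, hg v hv]
  obtain ⟨c, hc, rfl⟩ := hF.exists_eq_C_mul_of_dvd hG hG0 hdvd
  exact ⟨c, hc, fun v => by rw [← hGe]; simp⟩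

/-- Only finitely many linear substitutions preserve a smooth form of degree at least three. -/
theorem finite_setOf_eval_mulVec_eq {σ : Type*} [Fintype σ] [DecidableEq σ]
    {F : MvPolynomial σ ℂ} {d : ℕ} (hd : 3 ≤ d) (hF : F.IsHomogeneous d)
    (hsm : ∀ v, v ≠ 0 → eval v F = 0 → ∃ i, eval v (pderiv i F) ≠ 0) :
    {g : GL σ ℂ | ∀ v, eval ((g : Matrix σ σ ℂ).mulVec v) F = eval v F}.Finite := by
  let φ : (σ → ℂ) → (σ → ℂ) →L[ℂ] ℂ := fun x =>
    ∑ i, eval x (pderiv i F) • ContinuousLinearMap.proj (R := ℂ) (φ := fun _ : σ => ℂ) i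
  have hφ : ∀ x i, φ x (Pi.single i 1) = eval x (pderiv i F) := fun x i => by
    simp [φ, Pi.single_apply]
  have hne : ∀ x, x ≠ 0 → φ x ≠ 0 := by
    intro x hx h0
    have hp : ∀ i, eval x (pderiv i F) = 0 := fun i => by rw [← hφ, h0]; rfl
    -- Euler's identity turns a critical point into a zero of `F`, since `d ≠ 0`; smoothness
    -- excludes it.
    have heuler := congrArg (eval x) hF.sum_X_mul_pderiv
    simp only [map_sum, map_mul, hp, mul_zero, Finset.sum_const_zero, nsmul_eq_mul,
      map_natCast] at heuler
    obtain ⟨i, hi⟩ := hsm x hx ((mul_eq_zero.1 heuler.symm).resolve_left (by norm_cast; omega))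
    exact hi (hp i)
  have hfin := finite_setOf_units_comp_eq (f := fun x => eval x F) (φ := φ) (m := d - 1) (by omega)
    (hasFDerivAt_eval F)
    (continuous_finsetSum _ fun i _ => (continuous_eval (pderiv i F)).smul continuous_const)
    (fun a x => by simp only [φ, hF.pderiv.eval_smul, mul_smul, Finset.smul_sum]) hne
  let e : Matrix σ σ ℂ →* ((σ → ℂ) →L[ℂ] (σ → ℂ)) :=
    { toFun := fun g => LinearMap.toContinuousLinearMap g.mulVecLin
      map_one' := by ext; simp
      map_mul' := fun a b => by ext; simp }
  have he : Function.Injective (Units.map e) := by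
    refine Units.map_injective fun a b hab => Matrix.mulVec_injective ?_
    funext v
    exact congrArg (fun T : (σ → ℂ) →L[ℂ] (σ → ℂ) => T v) hab
  exact hfin.preimage he.injOn

end MvPolynomial

/-! ### Passage to the projective linear group -/

theorem mulVec_mem_projZeroLocus_of_mem_stabilizer {n d : ℕ}
    {F : MvPolynomial (Fin (n + 1)) ℂ} (hF : F.IsHomogeneous d)
    {g : GL (Fin (n + 1)) ℂ}
    (hg : Matrix.ProjGenLinGroup.mk g ∈ MulAction.stabilizer
      (Matrix.ProjGenLinGroup (Fin (n + 1)) ℂ) (projZeroLocus F))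
    (v : Fin (n + 1) → ℂ) (hv : MvPolynomial.eval v F = 0) :
    MvPolynomial.eval ((g : Matrix _ _ ℂ).mulVec v) F = 0 := by
  rcases eq_or_ne v 0 with rfl | h0
  · simpa using hv
  · have h1 := Set.smul_mem_smul_set (a := Matrix.ProjGenLinGroup.mk g)
      ((mk_mem_projZeroLocus hF v h0).2 hv)
    rw [MulAction.mem_stabilizer_iff.1 hg, Projectivization.PGL.mk_smul_mk,
      mk_mem_projZeroLocus hF] at h1
    exact h1

theorem mainTheorem11 (n d : ℕ) (hn : 2 ≤ n) (hd : 3 ≤ d)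
    (V : Set (ℙ ℂ (Fin (n + 1) → ℂ))) (hV : IsSmoothHypersurface n d V) :
    Finite (MulAction.stabilizer (Matrix.ProjGenLinGroup (Fin (n + 1)) ℂ) V) := by
  obtain ⟨F, hF0, hF, rfl, hsm⟩ := hV
  have : Nontrivial (Fin (n + 1)) := Fin.nontrivial_iff_two_le.2 (by omega)
  refine Set.Finite.subset
    ((MvPolynomial.finite_setOf_eval_mulVec_eq hd hF hsm).image Matrix.ProjGenLinGroup.mk) ?_
  intro p hp
  obtain ⟨g, rfl⟩ := Matrix.ProjGenLinGroup.mk_surjective p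
  obtain ⟨c, hc, hgc⟩ := MvPolynomial.exists_eval_mulVec_eq_mul hF0 hF hsm g
    (mulVec_mem_projZeroLocus_of_mem_stabilizer hF hp)
  -- With `z ^ d = c⁻¹`, the matrix `z g` fixes `F` exactly and has the same projective class as
  -- `g`.
  obtain ⟨z, hz⟩ := IsAlgClosed.exists_pow_nat_eq c⁻¹ (show 0 < d by omega)
  have hz0 : z ≠ 0 := by
    rintro rfl
    rw [zero_pow (by omega)] at hz
    exact inv_ne_zero hc hz.symm
  refine ⟨g * Matrix.GeneralLinearGroup.scalar _ (Units.mk0 z hz0), fun v => ?_, by simp⟩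
  have : ((g * Matrix.GeneralLinearGroup.scalar _ (Units.mk0 z hz0) : GL (Fin (n + 1)) ℂ) :
      Matrix (Fin (n + 1)) (Fin (n + 1)) ℂ).mulVec v = z • (g : Matrix (Fin (n + 1)) (Fin (n + 1)) ℂ).mulVec v := by
    rw [Units.val_mul, ← Matrix.mulVec_mulVec, ← Matrix.mulVec_smul]
    congr 1
    simp [Matrix.scalar_apply]
  rw [this, hF.eval_smul, hgc, hz, inv_mul_cancel_left₀ hc]
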